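/- Let $n\ge 0$ be an integer, let $[n]=\{0,\dots,n-1\}$, let $0<p\le 1$, and let $\epsilon$ be a real number. Oracle access to $f\colon[n]\to\{0,1\}$ acts on a query register $\mathsf Q=\mathsf Q_{\mathrm i}\mathsf Q_{\mathrm o}$ (query-input register $\mathbb C^{[n]}$, query-output qubit) through the unitary $O_f=\sum_{x,y}|x,y\oplus f(x)\rangle\langle x,y|$, followed by noise of rate $p$. In the error-concealing model the noise is $\rho\mapsto(1-p)\rho+p\,\mathcal N(\rho)$; in the error-signaling model it is $\rho\mapsto(1-p)\,\rho\otimes|0\rangle\langle 0|+p\,\mathcal N(\rho)\otimes|1\rangle\langle 1|$, so that every oracle call adds to the workspace of the algorithm a flag qubit that tells whether the error occurred. Here $\mathcal N$ is either the completely depolarizing channel $\mathcal N(\rho)=\operatorname{tr}(\rho)\,I_{\mathsf Q}/(2n)$ or the completely dephasing channel $\mathcal N(\rho)=\sum_{x\in[n]}(|x\rangle\langle x|\otimes I_{\mathsf Q_{\mathrm o}})\,\rho\,(|x\rangle\langle x|\otimes I_{\mathsf Q_{\mathrm o}})$. An algorithm with $\tau$ queries has a query register and a workspace of finitely many qubits.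 It starts in a fixed pure state; for $t=1,\dots,\tau$ it makes one noisy oracle call (which acts as the identity on the workspace, apart from adding the flag qubit in the error-signaling model) and then applies a fixed unitary $U_t$ to the whole memory; finally it performs a fixed projective measurement of the whole memory with outcomes in $[n]$. None of these components depends on $f$. The algorithm errs on $f$ if the outcome $a$ is unmarked, that is, if $f(a)=0$. The $\epsilon$-error quantum noisy-query complexity of unstructured search is the least $\tau$ for which some algorithm with $\tau$ queries errs with probability at most $\epsilon$ on every $f$ that has at least one marked element ($+\infty$ if there is none). **Theorem.** For both kinds of noise of rate $p$, the $\epsilon$-error quantum noisy-query complexity of unstructured search over $n$ elements is at least $$\frac{np(1-\epsilon)}{49}-1,$$ and the same lower bound holds in the error-signaling model. -/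

import Mathlib

open scoped Matrix Kronecker ENNReal

noncomputable section

/-- Basis labels `(x, y)` of the query register: the query-input register has basis `Fin n`,
the query-output register is one qubit. -/
abbrev Query (n : ℕ) : Type := Fin n × Bool

/-- Basis labels of the whole memory: the query register and a workspace of `k` qubits. -/
abbrev Mem (n k : ℕ) : Type := Query n × (Fin k → Bool)

/-- Linear operators (in particular density operators) on the space with basis `S`. -/
abbrev Op (S : Type) : Type := Matrix S S ℂ

/-- The two kinds of noise. -/
inductive NoiseKind where
  | depolarizing
  | dephasing

/-- The noiseless oracle `O_f = ∑ x y, |x, y ⊕ f x⟩⟨x, y|`. -/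
def oracleMatrix {n : ℕ} (f : Fin n → Bool) : Op (Query n) :=
  ∑ x : Fin n, ∑ y : Bool, Matrix.single (x, xor y (f x)) (x, y) 1

/-- The channel `ρ ↦ O_f ρ O_f†` of the noiseless oracle. -/
def oracleChannel {n : ℕ} (f : Fin n → Bool) (ρ : Op (Query n)) : Op (Query n) :=
  oracleMatrix f * ρ * (oracleMatrix f)ᴴ

/-- The noise conditioned on the error occurring. Complete depolarization replaces the state of
the whole query register by the maximally mixed state; complete dephasing projects the
query-input register to the computational basis. -/
def completeNoise {n : ℕ} : NoiseKind → Op (Query n) → Op (Query n)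
  | .depolarizing, ρ => (ρ.trace / (2 * n : ℂ)) • (1 : Op (Query n))
  | .dephasing, ρ => ∑ x : Fin n,
      (Matrix.single x x (1 : ℂ) ⊗ₖ (1 : Op Bool)) * ρ *
        (Matrix.single x x (1 : ℂ) ⊗ₖ (1 : Op Bool))

/-- The noise of rate `p`: `ρ ↦ (1 - p) ρ + p N(ρ)`. -/
def noise {n : ℕ} (N : NoiseKind) (p : ℝ) (ρ : Op (Query n)) : Op (Query n) :=
  ((1 - p : ℝ) : ℂ) • ρ + (p : ℂ) • completeNoise N ρ

/-- The error-signaling noise of rate `p`: it adds a flag qubit, which is in the state `|0⟩`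
(`false`) if no error has occurred and in the state `|1⟩` (`true`) if the error has occurred. -/
def noiseFlag {n : ℕ} (N : NoiseKind) (p : ℝ) (ρ : Op (Query n)) : Op (Query n × Bool) :=
  ((1 - p : ℝ) : ℂ) • (ρ ⊗ₖ Matrix.single false false (1 : ℂ)) +
    (p : ℂ) • (completeNoise N ρ ⊗ₖ Matrix.single true true (1 : ℂ))

/-- The operator `⟨w| ρ |w'⟩` on the query register, for workspace basis states `w`, `w'`. -/
def block {n k : ℕ} (ρ : Op (Mem n k)) (w w' : Fin k → Bool) : Op (Query n) :=
  Matrix.of fun q q' => ρ (q, w) (q', w')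

/-- The error-concealing noisy oracle call on the whole memory: the channel `noise ∘ oracle` on
the query register, tensored with the identity channel on the workspace. -/
def concealingCall {n : ℕ} (N : NoiseKind) (p : ℝ) (f : Fin n → Bool) {k : ℕ}
    (ρ : Op (Mem n k)) : Op (Mem n k) :=
  Matrix.of fun i j => noise N p (oracleChannel f (block ρ i.2 j.2)) i.1 j.1

/-- The error-signaling noisy oracle call on the whole memory: the channel `noiseFlag ∘ oracle`
on the query register, tensored with the identity channel on the workspace. The flag qubit
becomes the last qubit of the workspace. -/
def signalingCall {n : ℕ} (N : NoiseKind) (p : ℝ) (f : Fin n → Bool) {k : ℕ}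
    (ρ : Op (Mem n k)) : Op (Mem n (k + 1)) :=
  Matrix.of fun i j =>
    noiseFlag N p (oracleChannel f (block ρ (Fin.init i.2) (Fin.init j.2)))
      (i.1, i.2 (Fin.last k)) (j.1, j.2 (Fin.last k))

/-- A search algorithm with `τ` queries whose workspace has `size t` qubits after `t` queries:
an initial pure state, input-independent unitaries (`U t` follows query number `t + 1`; those
with `t ≥ τ` are never used), and a final projective measurement with outcomes in `Fin n`. -/
structure SearchAlgorithm (n τ : ℕ) (size : ℕ → ℕ) where
  init : EuclideanSpace ℂ (Mem n (size 0))
  norm_init : ‖init‖ = 1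
  U : (t : ℕ) → Matrix.unitaryGroup (Mem n (size (t + 1))) ℂ
  proj : Fin n → Op (Mem n (size τ))
  proj_hermitian : ∀ a, (proj a).IsHermitian
  proj_idempotent : ∀ a, proj a * proj a = proj a
  proj_sum : ∑ a, proj a = 1

namespace SearchAlgorithm

variable {n τ : ℕ} {size : ℕ → ℕ}

/-- The state after `t` rounds, each an oracle call followed by a unitary, where
`call t` is the oracle call number `t + 1`. -/
def state (A : SearchAlgorithm n τ size)
    (call : (t : ℕ) → Op (Mem n (size t)) → Op (Mem n (size (t + 1)))) :
    (t : ℕ) → Op (Mem n (size t))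
  | 0 => Matrix.vecMulVec (fun i => A.init i) (fun i => star (A.init i))
  | t + 1 => (A.U t : Op (Mem n (size (t + 1)))) * call t (state A call t) *
      (A.U t : Op (Mem n (size (t + 1))))ᴴ

/-- The probability that the answer is an unmarked input of `f`. -/
def errorProb (A : SearchAlgorithm n τ size)
    (call : (t : ℕ) → Op (Mem n (size t)) → Op (Mem n (size (t + 1))))
    (f : Fin n → Bool) : ℝ :=
  ∑ a : Fin n with f a = false, ((A.proj a * A.state call τ).trace).re

end SearchAlgorithm

/-- There is an algorithm with `τ` queries to the error-concealing noisy oracle that errs with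
probability at most `ε` for every `f` with at least one marked input. -/
def ConcealingSolvable (N : NoiseKind) (n : ℕ) (p ε : ℝ) (τ : ℕ) : Prop :=
  ∃ (l : ℕ) (A : SearchAlgorithm n τ (fun _ => l)), ∀ f : Fin n → Bool, (∃ x, f x = true) →
    A.errorProb (fun _ ρ => concealingCall N p f ρ) f ≤ ε

/-- There is an algorithm with `τ` queries to the error-signaling noisy oracle that errs with
probability at most `ε` for every `f` with at least one marked input. -/
def SignalingSolvable (N : NoiseKind) (n : ℕ) (p ε : ℝ) (τ : ℕ) : Prop :=
  ∃ (l : ℕ) (A : SearchAlgorithm n τ (fun t => l + t)), ∀ f : Fin n → Bool, (∃ x, f x = true) →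
    A.errorProb (fun _ ρ => signalingCall N p f ρ) f ≤ ε

/-- The `ε`-error noisy-query complexity of unstructured search (error-concealing oracle):
the least number of queries of an algorithm, `⊤` if there is none. -/
def concealingComplexity (N : NoiseKind) (n : ℕ) (p ε : ℝ) : ℕ∞ :=
  ⨅ (τ : ℕ) (_ : ConcealingSolvable N n p ε τ), (τ : ℕ∞)

/-- The `ε`-error noisy-query complexity of unstructured search with the error-signaling
oracle: the least number of queries of an algorithm, `⊤` if there is none. -/
def signalingComplexity (N : NoiseKind) (n : ℕ) (p ε : ℝ) : ℕ∞ :=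
  ⨅ (τ : ℕ) (_ : SignalingSolvable N n p ε τ), (τ : ℕ∞)

end

/-!
The search problem is hard already for the functions `f_x` with a single marked element `x`. Fix
`x` and compare the run with the oracle for `f_x` to the run with no marked element.

Both kinds of noise have Kraus operators that reveal to the environment the query input whenever
an error occurs, so the error histories of a run record queried inputs. Keep only the histories
that never record `x`; they give two families of unnormalized vectors, the columns of matrices `M`
(no marked element) and `N` (marked element `x`). Two things can happen to them in a query:

* the squared norm of `N` drops by `p` times the squared norm of the part of `N` that queries `x`
  (`hs_branches_self`);
* the overlap of `M` and `N` drops by at most twice the product of the norms of the parts of `M`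
  and of `N` that query `x`. By Young's inequality this is at most `4 / p` times the query weight
  of `M` at `x` plus a quarter of the loss of `N` in the first item (`le_hs_branches`).

Thus quantum interference is paid for by lost norm. If `W` is the total query weight at `x` of the
run without marked elements, and `L = 1 - ‖N‖²` is the total loss, then the overlap is at least
`1 - 4 W / p - L / 4` at the end (`exists_unrecorded`), hence `‖M - N‖² ≤ 8 W / p - L / 2`. Counting
all the lost norm as success, the success probability for `f_x` is at most
`L + 2 ‖M - N‖² + 2 r ≤ 16 W / p + 2 r`, where `r` is the probability that the run without marked
elements outputs `x` (`success_le`). Summed over `x`, the weights `W` give the number of queries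
`τ` and the `r` give `1`, so `n (1 - ε) ≤ 16 τ / p + 2`, which is stronger than the claim.

The argument uses only the Kraus operators, so that it applies to the error-concealing and the
error-signaling oracle alike (`IsRecordingCall`).
-/

open scoped ComplexOrder

noncomputable section

/-! ### The real Hilbert–Schmidt form -/

/-- The real part `Re tr (A† B)` of the Hilbert–Schmidt inner product. -/
def hs {S ι : Type} [Fintype S] [Fintype ι] (A B : Matrix S ι ℂ) : ℝ := ((Aᴴ * B).trace).re

section HilbertSchmidt

variable {S ι : Type} [Fintype S] [Fintype ι]

lemma hs_self_nonneg (A : Matrix S ι ℂ) : 0 ≤ hs A A :=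
  (Complex.nonneg_iff.1 (Matrix.posSemidef_conjTranspose_mul_self A).trace_nonneg).1

lemma hs_comm (A B : Matrix S ι ℂ) : hs A B = hs B A := by
  unfold hs
  rw [← Complex.conj_re, starRingEnd_apply, ← Matrix.trace_conjTranspose]
  simp

lemma hs_add_right (A B C : Matrix S ι ℂ) : hs A (B + C) = hs A B + hs A C := by
  simp [hs, Matrix.mul_add]

lemma hs_sub_right (A B C : Matrix S ι ℂ) : hs A (B - C) = hs A B - hs A C := by
  simp [hs, Matrix.mul_sub]

lemma hs_smul_right (c : ℝ) (A B : Matrix S ι ℂ) : hs A ((c : ℂ) • B) = c * hs A B := by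
  simp [hs]

lemma hs_sub_self (A B : Matrix S ι ℂ) :
    hs (A - B) (A - B) = hs A A - 2 * hs A B + hs B B := by
  rw [hs_sub_right, hs_comm _ A, hs_comm _ B, hs_sub_right, hs_sub_right, hs_comm B A]
  ring

lemma hs_self_le (A B : Matrix S ι ℂ) : hs B B ≤ 2 * hs A A + 2 * hs (A - B) (A - B) := by
  have h := hs_self_nonneg (A - (B - A))
  rw [hs_sub_self, hs_sub_self, hs_sub_right, hs_comm B A] at h
  rw [hs_sub_self]
  linarith

/-- Young's inequality with weight `c`. -/
lemma abs_hs_le (A B : Matrix S ι ℂ) {c : ℝ} (hc : 0 < c) :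
    |hs A B| ≤ (c * hs A A + hs B B / c) / 2 := by
  have key (e : ℝ) : 0 ≤ e ^ 2 * hs A A - 2 * (e * hs A B) + hs B B := by
    have h := hs_self_nonneg ((e : ℂ) • A - B)
    rwa [hs_sub_self, hs_smul_right, hs_comm _ A, hs_smul_right, hs_comm _ B, hs_smul_right,
      hs_comm B A, ← mul_assoc e e, ← sq] at h
  have h1 := key c
  have h2 := key (-c)
  have e : (c * hs A A + hs B B / c) / 2 = (c ^ 2 * hs A A + hs B B) / (2 * c) := by
    field_simp
  rw [e, le_div_iff₀ (by positivity)]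
  rcases abs_cases (hs A B) with ⟨h, -⟩ | ⟨h, -⟩ <;> rw [h] <;> nlinarith

lemma hs_mul_right {T : Type} [Fintype T] (B : Matrix T S ℂ) (A : Matrix T ι ℂ)
    (C : Matrix S ι ℂ) : hs A (B * C) = hs (Bᴴ * A) C := by
  simp [hs, Matrix.mul_assoc]

lemma trace_mul_mul_conjTranspose (Q : Matrix S S ℂ) (A : Matrix S ι ℂ) :
    ((Q * (A * Aᴴ)).trace).re = hs A (Q * A) := by
  rw [hs, ← Matrix.mul_assoc, Matrix.trace_mul_comm]

lemma hs_proj_mul {Q : Matrix S S ℂ} (hQ : Q.IsHermitian) (hQ2 : Q * Q = Q)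
    (A B : Matrix S ι ℂ) : hs A (Q * B) = hs (Q * A) (Q * B) := by
  conv_lhs => rw [← hQ2, Matrix.mul_assoc, hs_mul_right, hQ.eq]

lemma hs_proj_le [DecidableEq S] {Q : Matrix S S ℂ} (hQ : Q.IsHermitian) (hQ2 : Q * Q = Q)
    (A : Matrix S ι ℂ) : hs (Q * A) (Q * A) ≤ hs A A := by
  have h := hs_self_nonneg (A - Q * A)
  rw [hs_sub_self, hs_proj_mul hQ hQ2] at h
  linarith

lemma hs_isometry_mul [DecidableEq S] {O : Matrix S S ℂ} (hO : Oᴴ * O = 1)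
    (A B : Matrix S ι ℂ) : hs (O * A) (O * B) = hs A B := by
  rw [hs_mul_right, ← Matrix.mul_assoc, hO, Matrix.one_mul]

lemma trace_proj_mul_nonneg {Q A : Matrix S S ℂ} (hQ : Q.IsHermitian) (hQ2 : Q * Q = Q)
    (hA : A.PosSemidef) : 0 ≤ ((Q * A).trace).re := by
  have h := (Complex.nonneg_iff.1 (hA.mul_mul_conjTranspose_same Q).trace_nonneg).1
  rwa [Matrix.trace_mul_comm, ← Matrix.mul_assoc, hQ.eq, hQ2] at h

lemma hs_proj_le_trace {Q ρ : Matrix S S ℂ} (hQ : Q.IsHermitian) (hQ2 : Q * Q = Q)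
    {A : Matrix S ι ℂ} (hA : (ρ - A * Aᴴ).PosSemidef) :
    hs (Q * A) (Q * A) ≤ ((Q * ρ).trace).re := by
  have h := trace_proj_mul_nonneg hQ hQ2 hA
  rw [Matrix.mul_sub, Matrix.trace_sub, Complex.sub_re, trace_mul_mul_conjTranspose,
    hs_proj_mul hQ hQ2] at h
  linarith

end HilbertSchmidt

/-! ### Kraus branches and one step of the evolution -/

section Branches

variable {S S' K ι : Type} [Fintype S] [Fintype ι]

/-- Apply the Kraus operators `J i`, `i ∈ s`, to a family of vectors, the columns of `M`. The
columns of the result are indexed by the old branch and the new Kraus index. -/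
def branches (J : K → Matrix S' S ℂ) (s : Finset K) (M : Matrix S ι ℂ) :
    Matrix S' (ι × s) ℂ :=
  Matrix.of fun a e => (J e.2 * M) a e.1

lemma branches_mul_conjTranspose (J : K → Matrix S' S ℂ) (s : Finset K) (M : Matrix S ι ℂ) :
    branches J s M * (branches J s M)ᴴ = ∑ i ∈ s, J i * (M * Mᴴ) * (J i)ᴴ := by
  have h (i : K) : J i * (M * Mᴴ) * (J i)ᴴ = (J i * M) * (J i * M)ᴴ := by
    simp [Matrix.mul_assoc]
  simp_rw [h]
  ext a b
  rw [Matrix.sum_apply, ← Finset.sum_coe_sort s, Matrix.mul_apply, Fintype.sum_prod_type,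
    Finset.sum_comm]
  rfl

lemma hs_branches [Fintype S'] (J : K → Matrix S' S ℂ) (s : Finset K) (M N : Matrix S ι ℂ) :
    hs (branches J s M) (branches J s N) = hs M ((∑ i ∈ s, (J i)ᴴ * J i) * N) := by
  have h : ((branches J s M)ᴴ * branches J s N).trace
      = ∑ i ∈ s, ((J i * M)ᴴ * (J i * N)).trace := by
    rw [← Finset.sum_coe_sort s, Matrix.trace, Fintype.sum_prod_type, Finset.sum_comm]
    rfl
  rw [hs, hs, h, Matrix.sum_mul, Matrix.mul_sum, Matrix.trace_sum]
  simp [Matrix.mul_assoc]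

/-- Keeping only the Kraus branches in `s` preserves domination by the full state. -/
lemma posSemidef_sub_branches [Fintype S'] [Fintype K] (J : K → Matrix S' S ℂ) (s : Finset K)
    {ρ : Matrix S S ℂ} {M : Matrix S ι ℂ} (h : (ρ - M * Mᴴ).PosSemidef) :
    (∑ i, J i * ρ * (J i)ᴴ - branches J s M * (branches J s M)ᴴ).PosSemidef := by
  classical
  have hρ : ρ.PosSemidef := by
    simpa using h.add (Matrix.posSemidef_self_mul_conjTranspose M)
  have e : ∑ i, J i * ρ * (J i)ᴴ - branches J s M * (branches J s M)ᴴ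
      = ∑ i ∈ s, J i * (ρ - M * Mᴴ) * (J i)ᴴ + ∑ i ∈ sᶜ, J i * ρ * (J i)ᴴ := by
    rw [branches_mul_conjTranspose, ← Finset.sum_add_sum_compl s]
    simp only [Matrix.mul_sub, Matrix.sub_mul, Finset.sum_sub_distrib]
    abel
  rw [e]
  exact (Matrix.posSemidef_sum _ fun i _ => h.mul_mul_conjTranspose_same _).add
    (Matrix.posSemidef_sum _ fun i _ => hρ.mul_mul_conjTranspose_same _)

variable [Fintype S'] [DecidableEq S] {O P : Matrix S S ℂ} {J : K → Matrix S' S ℂ}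
  {s : Finset K} {p : ℝ}

/-- The weight of the branches that do not record the marked element drops by `p` times the
weight of the query at the marked element. -/
lemma hs_branches_self (hP : P.IsHermitian) (hP2 : P * P = P) (hO : Oᴴ * O = 1)
    (hOP : O * P = P * O) (hJ : ∑ i ∈ s, (J i)ᴴ * J i = 1 - (p : ℂ) • P) (N : Matrix S ι ℂ) :
    hs (branches J s (O * N)) (branches J s (O * N)) = hs N N - p * hs (P * N) (P * N) := by
  rw [hs_branches, hJ, Matrix.sub_mul, Matrix.one_mul, hs_sub_right, hs_isometry_mul hO,
    Matrix.smul_mul, hs_smul_right, hs_proj_mul hP hP2, ← Matrix.mul_assoc, ← hOP,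
    Matrix.mul_assoc, hs_isometry_mul hO]

/-- In one step, the overlap of the branches without and with a marked element decreases only
through the query at the marked element. The two weights balance the final estimate: the second
term is a quarter of the simultaneous drop given by `hs_branches_self`. -/
lemma le_hs_branches (hp : 0 < p) (hp1 : p ≤ 1) (hP : P.IsHermitian) (hP2 : P * P = P)
    (hO : Oᴴ * O = 1) (hOP : O * P = P * O) (hO1 : O * (1 - P) = 1 - P)
    (hJ : ∑ i ∈ s, (J i)ᴴ * J i = 1 - (p : ℂ) • P) (M N : Matrix S ι ℂ) :
    hs M N - (4 / p * hs (P * M) (P * M) + p / 4 * hs (P * N) (P * N)) ≤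
      hs (branches J s M) (branches J s (O * N)) := by
  have e1 : O * N = N - P * N + O * (P * N) := by
    have : O = 1 - P + O * P := by rw [← hO1, Matrix.mul_sub, Matrix.mul_one]; abel
    conv_lhs => rw [this]
    simp [Matrix.add_mul, Matrix.sub_mul, Matrix.mul_assoc]
  have e2 : P * (O * N) = O * (P * N) := by
    rw [← Matrix.mul_assoc, ← hOP, Matrix.mul_assoc]
  have e3 : hs M (O * (P * N)) = hs (P * M) (O * (P * N)) := by
    rw [← e2, hs_proj_mul hP hP2]
  have e : hs (branches J s M) (branches J s (O * N))
      = hs M N - hs (P * M) (P * N) + (1 - p) * hs (P * M) (O * (P * N)) := by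
    rw [hs_branches, hJ, Matrix.sub_mul, Matrix.one_mul, Matrix.smul_mul, e2, hs_sub_right,
      hs_smul_right, e1, hs_add_right, hs_sub_right, hs_proj_mul hP hP2 M N, e3]
    ring
  have hc : 0 < 4 / p := by positivity
  have h1 := abs_le.1 (abs_hs_le (P * M) (P * N) hc)
  have h2 := abs_le.1 (abs_hs_le (P * M) (O * (P * N)) hc)
  rw [hs_isometry_mul hO] at h2
  have e4 : hs (P * N) (P * N) / (4 / p) = p / 4 * hs (P * N) (P * N) := by
    field_simp
  rw [e4] at h1 h2
  have h3 : 0 ≤ 4 / p * hs (P * M) (P * M) + p / 4 * hs (P * N) (P * N) := by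
    have := hs_self_nonneg (P * M)
    have := hs_self_nonneg (P * N)
    positivity
  rw [e]
  nlinarith [h1.2, mul_le_mul_of_nonneg_left h2.1 (sub_nonneg.2 hp1)]

end Branches

/-! ### The oracle and the query projections on the whole memory -/

section Oracle

variable {n k : ℕ}

/-- The projection of the query-input register to `|x⟩`, acting on the whole memory. -/
def queryProj (k : ℕ) (x : Fin n) : Op (Mem n k) :=
  Matrix.diagonal fun m => if m.1.1 = x then 1 else 0

lemma queryProj_isHermitian (x : Fin n) : (queryProj k x).IsHermitian := by
  rw [queryProj, Matrix.isHermitian_diagonal_iff]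
  intro m
  split_ifs
  · exact IsSelfAdjoint.one _
  · exact IsSelfAdjoint.zero _

lemma queryProj_mul_self (x : Fin n) : queryProj k x * queryProj k x = queryProj k x := by
  simp [queryProj]

lemma sum_queryProj : ∑ x, queryProj k x = (1 : Op (Mem n k)) := by
  rw [← Matrix.diagonal_one]
  ext a b
  by_cases h : a = b
  · subst h; simp [queryProj, Matrix.sum_apply]
  · simp [queryProj, Matrix.sum_apply, h]

/-- The noiseless oracle acting on the whole memory. -/
def memOracle (k : ℕ) (f : Fin n → Bool) : Op (Mem n k) := oracleMatrix f ⊗ₖ 1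

lemma oracleMatrix_apply (f : Fin n → Bool) (a b : Query n) :
    oracleMatrix f a b = if a = (b.1, xor b.2 (f b.1)) then 1 else 0 := by
  obtain ⟨x, y⟩ := b
  rw [oracleMatrix, Matrix.sum_apply, Finset.sum_eq_single x]
  · rw [Matrix.sum_apply, Finset.sum_eq_single y]
    · simp [Matrix.single_apply, eq_comm]
    · intro z _ hz; simp [hz]
    · simp
  · intro z _ hz; simp [Matrix.sum_apply, hz]
  · simp

lemma memOracle_apply (f : Fin n → Bool) (a b : Mem n k) :
    memOracle k f a b = if a = ((b.1.1, xor b.1.2 (f b.1.1)), b.2) then 1 else 0 := by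
  rw [memOracle, Matrix.kroneckerMap_apply, oracleMatrix_apply, Matrix.one_apply]
  by_cases h : a.2 = b.2 <;> simp [h, Prod.ext_iff]

lemma memOracle_isometry (f : Fin n → Bool) : (memOracle k f)ᴴ * memOracle k f = 1 := by
  ext a b
  rw [Matrix.mul_apply, Matrix.one_apply]
  simp only [Matrix.conjTranspose_apply, memOracle_apply]
  rw [Finset.sum_eq_single ((b.1.1, xor b.1.2 (f b.1.1)), b.2)]
  · obtain ⟨⟨x, y⟩, w⟩ := a
    obtain ⟨⟨x', y'⟩, w'⟩ := b
    by_cases hx : x = x'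
    · subst hx
      by_cases hy : y = y' <;> simp [hy, eq_comm]
    · simp [hx, eq_comm]
  · intro c _ hc; simp [hc]
  · simp

lemma memOracle_const_false : memOracle k (fun _ : Fin n => false) = 1 := by
  ext a b
  simp [memOracle_apply, Matrix.one_apply]

lemma memOracle_mul_queryProj (f : Fin n → Bool) (x : Fin n) :
    memOracle k f * queryProj k x = queryProj k x * memOracle k f := by
  ext a b
  rw [queryProj, Matrix.mul_diagonal, Matrix.diagonal_mul, memOracle_apply, mul_comm]
  by_cases h : a = ((b.1.1, xor b.1.2 (f b.1.1)), b.2)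
  · subst h; rfl
  · simp [h]

/-- The oracle for the single marked element `x` acts trivially on queries other than `x`. -/
lemma memOracle_mul_one_sub (x : Fin n) :
    memOracle k (fun y => decide (y = x)) * (1 - queryProj k x) = 1 - queryProj k x := by
  have e : (1 : Op (Mem n k)) - queryProj k x =
      Matrix.diagonal fun m => if m.1.1 = x then 0 else 1 := by
    rw [queryProj, ← Matrix.diagonal_one, Matrix.diagonal_sub]
    congr 1; ext m; split_ifs <;> simp
  ext a b
  rw [e, Matrix.mul_diagonal, memOracle_apply, Matrix.diagonal_apply]
  by_cases hb : b.1.1 = x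
  · by_cases hab : a = b
    · subst hab; simp [hb]
    · simp [hb, hab]
  · by_cases hab : a = b
    · subst hab; simp [hb]
    · simp [hb, hab]

end Oracle

/-! ### Noisy oracle calls that record the query with rate `p` -/

/-- A call is a recording call of rate `p` if it is the noiseless oracle followed by a channel
(independent of `f`) with Kraus operators `J i`, each of which records at most one query
input `r i`, such that the operators recording `x` satisfy `∑ (J i)† (J i) = p |x⟩⟨x|`. The last
condition is expressed through the complementary sum. -/
def IsRecordingCall {n k k' : ℕ} (p : ℝ)
    (call : (Fin n → Bool) → Op (Mem n k) → Op (Mem n k')) : Prop :=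
  ∃ (K : Type) (_ : Fintype K) (J : K → Matrix (Mem n k') (Mem n k) ℂ) (r : K → Option (Fin n)),
    (∀ f ρ, call f ρ = ∑ i, J i * (memOracle k f * ρ * (memOracle k f)ᴴ) * (J i)ᴴ) ∧
    ∑ i, (J i)ᴴ * J i = 1 ∧
    ∀ x, ∑ i with r i ≠ some x, (J i)ᴴ * J i = 1 - (p : ℂ) • queryProj k x

section RecordingCall

variable {n k k' : ℕ} {p : ℝ} {call : (Fin n → Bool) → Op (Mem n k) → Op (Mem n k')}

/-- A unitary applied after a recording call can be absorbed into the Kraus operators. -/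
lemma IsRecordingCall.unitary_conj (h : IsRecordingCall p call) {U : Op (Mem n k')}
    (hU : Uᴴ * U = 1) : IsRecordingCall p fun f ρ => U * call f ρ * Uᴴ := by
  obtain ⟨K, _, J, r, h1, h2, h3⟩ := h
  have e (i : K) : (U * J i)ᴴ * (U * J i) = (J i)ᴴ * J i := by
    rw [Matrix.conjTranspose_mul, Matrix.mul_assoc, ← Matrix.mul_assoc Uᴴ, hU, Matrix.one_mul]
  refine ⟨K, inferInstance, fun i => U * J i, r, fun f ρ => ?_, ?_, fun x => ?_⟩
  · simp only [h1, Matrix.mul_sum, Matrix.sum_mul, Matrix.conjTranspose_mul, Matrix.mul_assoc]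
  · simpa only [e] using h2
  · simpa only [e] using h3 x

lemma IsRecordingCall.trace_eq (h : IsRecordingCall p call) (f : Fin n → Bool)
    (ρ : Op (Mem n k)) : (call f ρ).trace = ρ.trace := by
  obtain ⟨K, _, J, r, h1, h2, -⟩ := h
  rw [h1, Matrix.trace_sum]
  simp_rw [Matrix.trace_mul_comm _ (J _)ᴴ, ← Matrix.mul_assoc (J _)ᴴ]
  rw [← Matrix.trace_sum, ← Matrix.sum_mul, h2, Matrix.one_mul, Matrix.trace_mul_comm,
    ← Matrix.mul_assoc, memOracle_isometry, Matrix.one_mul]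

end RecordingCall

/-! ### The lower bound for recording calls -/

namespace SearchAlgorithm

variable {n τ : ℕ} {size : ℕ → ℕ} (A : SearchAlgorithm n τ size) {p : ℝ}
  {call : (t : ℕ) → (Fin n → Bool) → Op (Mem n (size t)) → Op (Mem n (size (t + 1)))}

lemma trace_state (hcall : ∀ t, IsRecordingCall p (call t)) (f : Fin n → Bool) (t : ℕ) :
    (A.state (fun t => call t f) t).trace = 1 := by
  induction t with
  | zero =>
    rw [state, Matrix.trace_vecMulVec]
    have h := A.norm_init
    rw [EuclideanSpace.norm_eq, Real.sqrt_eq_one] at h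
    rw [← Complex.ofReal_one, ← h, dotProduct]
    push_cast
    exact Finset.sum_congr rfl fun i _ => by
      rw [← Complex.mul_conj']; rfl
  | succ t ih =>
    rw [state, ← ih, ← (hcall t).trace_eq f, Matrix.trace_mul_comm, ← Matrix.mul_assoc]
    have hU : (A.U t : Op (Mem n (size (t + 1))))ᴴ * A.U t = 1 :=
      Matrix.UnitaryGroup.star_mul_self (A.U t)
    rw [hU, Matrix.one_mul]

/-- The weight with which the run without marked elements queries `x`, summed over the first `t`
queries. -/
def queryWeight (A : SearchAlgorithm n τ size)
    (call : (t : ℕ) → (Fin n → Bool) → Op (Mem n (size t)) → Op (Mem n (size (t + 1))))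
    (x : Fin n) (t : ℕ) : ℝ :=
  ∑ s ∈ Finset.range t,
    ((queryProj (size s) x * A.state (fun t => call t fun _ => false) s).trace).re

lemma sum_queryWeight (hcall : ∀ t, IsRecordingCall p (call t)) (t : ℕ) :
    ∑ x, A.queryWeight call x t = t := by
  unfold queryWeight
  rw [Finset.sum_comm]
  simp_rw [← Complex.re_sum, ← Matrix.trace_sum, ← Matrix.sum_mul, sum_queryProj, Matrix.one_mul,
    A.trace_state hcall]
  simp

/-- The histories that never record `x` provide families `M`, `N` of vectors, dominated by the
states of the runs with no marked element and with the single marked element `x`, whose overlap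
decreases only by the query weight at `x` and a quarter of the weight that `N` has lost. -/
lemma exists_unrecorded (hp : 0 < p) (hp1 : p ≤ 1) (hcall : ∀ t, IsRecordingCall p (call t))
    (x : Fin n) (t : ℕ) :
    ∃ (ι : Type) (_ : Fintype ι) (M N : Matrix (Mem n (size t)) ι ℂ),
      (A.state (fun t => call t fun _ => false) t - M * Mᴴ).PosSemidef ∧
      (A.state (fun t => call t fun y => decide (y = x)) t - N * Nᴴ).PosSemidef ∧
      1 - 4 / p * A.queryWeight call x t - (1 - hs N N) / 4 ≤ hs M N := by
  induction t with
  | zero =>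
    let M : Matrix (Mem n (size 0)) Unit ℂ := Matrix.of fun i _ => A.init i
    have hM (f : Fin n → Bool) : A.state (fun t => call t f) 0 = M * Mᴴ := by
      rw [state, Matrix.vecMulVec_eq Unit]; rfl
    have h1 : hs M M = 1 := by
      rw [hs, Matrix.trace_mul_comm, ← hM fun _ => false, A.trace_state hcall]; simp
    refine ⟨Unit, inferInstance, M, M, ?_, ?_, ?_⟩
    · rw [hM, sub_self]; exact Matrix.PosSemidef.zero
    · rw [hM, sub_self]; exact Matrix.PosSemidef.zero
    · simp [h1, queryWeight]
  | succ t ih =>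
    obtain ⟨ι, _, M, N, hM, hN, h⟩ := ih
    have hU : (A.U t : Op (Mem n (size (t + 1))))ᴴ * A.U t = 1 :=
      Matrix.UnitaryGroup.star_mul_self (A.U t)
    obtain ⟨K, _, J, r, h1, -, h3⟩ := (hcall t).unitary_conj hU
    beta_reduce at h1
    set s : Finset K := {i | r i ≠ some x}
    have hO := memOracle_isometry (k := size t) fun y => decide (y = x)
    have hOP := memOracle_mul_queryProj (k := size t) (fun y => decide (y = x)) x
    have hP := queryProj_isHermitian (k := size t) x
    have hP2 := queryProj_mul_self (k := size t) x
    set O := memOracle (size t) fun y => decide (y = x)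
    refine ⟨ι × s, inferInstance, branches J s M, branches J s (O * N), ?_, ?_, ?_⟩
    · rw [state, h1, memOracle_const_false]
      simpa using posSemidef_sub_branches J s hM
    · rw [state, h1]
      refine posSemidef_sub_branches J s ?_
      have := hN.mul_mul_conjTranspose_same O
      simpa only [Matrix.mul_sub, Matrix.sub_mul, Matrix.conjTranspose_mul, Matrix.mul_assoc]
        using this
    · have h4 := le_hs_branches hp hp1 hP hP2 hO hOP (memOracle_mul_one_sub x) (h3 x) M N
      have h5 := hs_branches_self hP hP2 hO hOP (h3 x) N
      have h6 := mul_le_mul_of_nonneg_left (hs_proj_le_trace hP hP2 hM)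
        (show 0 ≤ 4 / p by positivity)
      rw [queryWeight, Finset.sum_range_succ, ← queryWeight, mul_add, h5]
      linarith

/-- The success probability with the single marked element `x` exceeds (up to a constant factor)
the probability of outputting `x` without marked elements by at most the query weight over `p`. -/
lemma success_le (hp : 0 < p) (hp1 : p ≤ 1) (hcall : ∀ t, IsRecordingCall p (call t))
    (x : Fin n) :
    ((A.proj x * A.state (fun t => call t fun y => decide (y = x)) τ).trace).re ≤
      16 / p * A.queryWeight call x τ +
        2 * ((A.proj x * A.state (fun t => call t fun _ => false) τ).trace).re := by
  obtain ⟨ι, _, M, N, hM, hN, h⟩ := A.exists_unrecorded hp hp1 hcall x τ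
  have hQ := A.proj_hermitian x
  have hQ2 := A.proj_idempotent x
  have htr (f : Fin n → Bool) :
      ((1 * A.state (fun t => call t f) τ).trace).re = 1 := by
    rw [Matrix.one_mul, A.trace_state hcall]; simp
  have hM1 := hs_proj_le_trace Matrix.isHermitian_one (Matrix.one_mul 1) hM
  have hMQ := hs_proj_le_trace hQ hQ2 hM
  rw [htr, Matrix.one_mul] at hM1
  -- The lost weight of `N` is counted as success: `tr Q ρ ≤ tr ρ - tr N N† + tr Q N N†`.
  have hQ' : (1 - A.proj x).IsHermitian := Matrix.isHermitian_one.sub hQ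
  have hQ2' : (1 - A.proj x) * (1 - A.proj x) = 1 - A.proj x := by
    simp [Matrix.sub_mul, Matrix.mul_sub, hQ2]
  have hNQ := trace_proj_mul_nonneg hQ' hQ2' hN
  rw [Matrix.mul_sub, Matrix.trace_sub, Complex.sub_re, trace_mul_mul_conjTranspose,
    Matrix.sub_mul, Matrix.trace_sub, Complex.sub_re, htr, Matrix.sub_mul, Matrix.one_mul,
    hs_sub_right, hs_proj_mul hQ hQ2] at hNQ
  have hd := hs_sub_self M N
  have hdQ := hs_proj_le hQ hQ2 (M - N)
  have hNM := hs_self_le (A.proj x * M) (A.proj x * N)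
  rw [Matrix.mul_sub] at hdQ
  have e : 16 / p * A.queryWeight call x τ = 4 * (4 / p * A.queryWeight call x τ) := by ring
  rw [e]
  linarith

lemma errorProb_single (hcall : ∀ t, IsRecordingCall p (call t)) (x : Fin n) :
    A.errorProb (fun t => call t fun y => decide (y = x)) (fun y => decide (y = x)) =
      1 - ((A.proj x * A.state (fun t => call t fun y => decide (y = x)) τ).trace).re := by
  have h : ∑ a,
      ((A.proj a * A.state (fun t => call t fun y => decide (y = x)) τ).trace).re = 1 := by
    rw [← Complex.re_sum, ← Matrix.trace_sum, ← Matrix.sum_mul, A.proj_sum, Matrix.one_mul,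
      A.trace_state hcall]
    simp
  rw [← h, errorProb, eq_sub_iff_add_eq, ← Finset.sum_erase_add _ _ (Finset.mem_univ x)]
  congr 2
  ext a
  simp

/-- An algorithm with recording calls of rate `p` that errs with probability at most `ε` makes many
queries; only the functions with a single marked element are used. -/
theorem le_queries (hp : 0 < p) (hp1 : p ≤ 1) (hcall : ∀ t, IsRecordingCall p (call t)) {ε : ℝ}
    (hA : ∀ f : Fin n → Bool, (∃ x, f x = true) → A.errorProb (fun t => call t f) f ≤ ε) :
    (n : ℝ) * p * (1 - ε) / 49 - 1 ≤ τ := by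
  have h1 (x : Fin n) : 1 - ε ≤ 16 / p * A.queryWeight call x τ +
        2 * ((A.proj x * A.state (fun t => call t fun _ => false) τ).trace).re := by
    have h := hA (fun y => decide (y = x)) ⟨x, by simp⟩
    rw [A.errorProb_single hcall] at h
    linarith [A.success_le hp hp1 hcall x]
  have h2 := Finset.sum_le_sum fun x (_ : x ∈ Finset.univ) => h1 x
  rw [Finset.sum_add_distrib, ← Finset.mul_sum, ← Finset.mul_sum, A.sum_queryWeight hcall,
    ← Complex.re_sum, ← Matrix.trace_sum, ← Matrix.sum_mul, A.proj_sum, Matrix.one_mul,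
    A.trace_state hcall] at h2
  simp only [Finset.sum_const, Finset.card_univ, Fintype.card_fin, nsmul_eq_mul,
    Complex.one_re] at h2
  have h3 := mul_le_mul_of_nonneg_left h2 hp.le
  have e : p * (16 / p * τ + 2 * 1) = 16 * τ + 2 * p := by field_simp
  rw [e] at h3
  have : (0 : ℝ) ≤ τ := Nat.cast_nonneg _
  linarith

end SearchAlgorithm

/-! ### Kraus operators of the two kinds of noise -/

section Noise

variable {n : ℕ}

/-- Both complete noises have Kraus operators that record the query input. -/
lemma exists_kraus_completeNoise (N : NoiseKind) (n : ℕ) :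
    ∃ (K : Type) (_ : Fintype K) (c : K → Op (Query n)) (r : K → Fin n),
      (∀ ρ, completeNoise N ρ = ∑ i, c i * ρ * (c i)ᴴ) ∧
      ∀ x, ∑ i with r i = x, (c i)ᴴ * c i = Matrix.single x x (1 : ℂ) ⊗ₖ (1 : Op Bool) := by
  cases N with
  | dephasing =>
    have h (x : Fin n) : (Matrix.single x x (1 : ℂ) ⊗ₖ (1 : Op Bool))ᴴ =
        Matrix.single x x (1 : ℂ) ⊗ₖ (1 : Op Bool) := by
      simp [Matrix.conjTranspose_kronecker]
    refine ⟨Fin n, inferInstance, fun x => Matrix.single x x (1 : ℂ) ⊗ₖ (1 : Op Bool), id,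
      fun ρ => ?_, fun x => ?_⟩
    · simp only [h, completeNoise]
    · simp only [h, id]
      rw [Finset.filter_eq' Finset.univ x, if_pos (Finset.mem_univ x), Finset.sum_singleton,
        ← Matrix.mul_kronecker_mul]
      simp
  | depolarizing =>
    -- The Kraus operators are `|a⟩⟨b| / √(2n)`, and `|a⟩⟨b|` records the query input of `b`.
    have hc : star (((Real.sqrt (2 * n))⁻¹ : ℝ) : ℂ) * (((Real.sqrt (2 * n))⁻¹ : ℝ) : ℂ)
        = (2 * n : ℂ)⁻¹ := by
      rw [Complex.star_def, Complex.conj_ofReal, ← Complex.ofReal_mul, ← mul_inv,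
        Real.mul_self_sqrt (by positivity)]
      push_cast; rfl
    refine ⟨Query n × Query n, inferInstance,
      fun i => (((Real.sqrt (2 * n))⁻¹ : ℝ) : ℂ) • Matrix.single i.1 i.2 (1 : ℂ), fun i => i.2.1,
      fun ρ => ?_, fun x => ?_⟩
    · have e (i : Query n × Query n) :
          ((((Real.sqrt (2 * n))⁻¹ : ℝ) : ℂ) • Matrix.single i.1 i.2 (1 : ℂ)) * ρ *
            ((((Real.sqrt (2 * n))⁻¹ : ℝ) : ℂ) • Matrix.single i.1 i.2 (1 : ℂ))ᴴ
          = (2 * n : ℂ)⁻¹ • Matrix.single i.1 i.1 (ρ i.2 i.2) := by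
        rw [← hc, Matrix.conjTranspose_smul, Matrix.smul_mul, Matrix.mul_smul, Matrix.smul_mul,
          smul_smul, Matrix.conjTranspose_single, Matrix.single_mul_mul_single]
        simp
      simp only [e, completeNoise]
      rw [← Finset.smul_sum, Fintype.sum_prod_type]
      ext a b
      by_cases hab : a = b
      · subst hab
        simp [Matrix.sum_apply, Matrix.single_apply, Matrix.trace, div_eq_inv_mul]
      · have h2 (z : Query n) : ¬ (z = a ∧ z = b) := fun h => hab (h.1.symm.trans h.2)
        simp [Matrix.sum_apply, hab, h2]
    · have hn : (n : ℂ) ≠ 0 := Nat.cast_ne_zero.2 (Fin.pos x).ne'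
      have e (i : Query n × Query n) :
          ((((Real.sqrt (2 * n))⁻¹ : ℝ) : ℂ) • Matrix.single i.1 i.2 (1 : ℂ))ᴴ *
            ((((Real.sqrt (2 * n))⁻¹ : ℝ) : ℂ) • Matrix.single i.1 i.2 (1 : ℂ))
          = (2 * n : ℂ)⁻¹ • Matrix.single i.2 i.2 (1 : ℂ) := by
        rw [← hc, Matrix.conjTranspose_smul, Matrix.smul_mul, Matrix.mul_smul, smul_smul,
          Matrix.conjTranspose_single]
        simp
      simp only [e]
      rw [Finset.sum_filter, Fintype.sum_prod_type]
      refine (Finset.sum_const (∑ b : Query n, if b.1 = x then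
        (2 * n : ℂ)⁻¹ • Matrix.single b b (1 : ℂ) else 0)).trans ?_
      rw [Finset.card_univ, ← Finset.sum_filter, ← Finset.smul_sum]
      have e2 : ∑ b : Query n with b.1 = x, Matrix.single b b (1 : ℂ)
          = Matrix.single x x (1 : ℂ) ⊗ₖ (1 : Op Bool) := by
        rw [Finset.sum_filter, Fintype.sum_prod_type, Finset.sum_eq_single x]
        · ext ⟨a, b⟩ ⟨a', b'⟩
          cases b <;> cases b' <;>
            simp [Matrix.single_apply, Matrix.kroneckerMap_apply]
        · intro z _ hz; simp [hz]
        · simp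
      rw [e2, ← Nat.cast_smul_eq_nsmul ℂ, smul_smul]
      have e3 : ((Fintype.card (Query n) : ℕ) : ℂ) * (2 * n : ℂ)⁻¹ = 1 := by
        simp only [Fintype.card_prod, Fintype.card_fin, Fintype.card_bool]
        push_cast
        field_simp
      rw [e3, one_smul]

end Noise

section Calls

variable {n k k' : ℕ}

/-- The operator on workspaces that copies the basis state `v` to all `w` with `g w = v` on which
`good` holds. -/
def relabel (good : (Fin k' → Bool) → Prop) [DecidablePred good]
    (g : (Fin k' → Bool) → (Fin k → Bool)) : Matrix (Fin k' → Bool) (Fin k → Bool) ℂ :=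
  Matrix.of fun w v => if g w = v ∧ good w then 1 else 0

lemma kronecker_relabel_conj (good : (Fin k' → Bool) → Prop) [DecidablePred good]
    (g : (Fin k' → Bool) → (Fin k → Bool)) (C : Op (Query n)) (ρ : Op (Mem n k))
    (a b : Mem n k') :
    ((C ⊗ₖ relabel good g) * ρ * (C ⊗ₖ relabel good g)ᴴ) a b =
      if good a.2 ∧ good b.2 then (C * block ρ (g a.2) (g b.2) * Cᴴ) a.1 b.1 else 0 := by
  simp only [Matrix.mul_apply, Fintype.sum_prod_type, Matrix.kroneckerMap_apply, relabel,
    Matrix.of_apply, Matrix.conjTranspose_apply, block]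
  by_cases ha : good a.2 <;> by_cases hb : good b.2 <;>
    simp [ha, hb, apply_ite]

lemma relabel_isometry {good : (Fin k' → Bool) → Prop} [DecidablePred good]
    {g : (Fin k' → Bool) → (Fin k → Bool)} (h : ∀ v, ∃! w, g w = v ∧ good w) :
    (relabel good g)ᴴ * relabel good g = 1 := by
  ext v v'
  obtain ⟨w, ⟨hw, hw'⟩, hu⟩ := h v
  simp only [Matrix.mul_apply, relabel, Matrix.conjTranspose_apply, Matrix.of_apply]
  rw [Finset.sum_eq_single w, Matrix.one_apply]
  · simp [hw, hw']
  · intro u _ hne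
    rw [if_neg fun h => hne (hu u h)]
    simp
  · simp

lemma block_memOracle_conj (f : Fin n → Bool) (ρ : Op (Mem n k)) (w w' : Fin k → Bool) :
    block (memOracle k f * ρ * (memOracle k f)ᴴ) w w' = oracleChannel f (block ρ w w') := by
  have h : (1 : Op (Fin k → Bool)) = relabel (fun _ => True) id := by
    ext a b
    simp [relabel, Matrix.one_apply]
  ext a b
  rw [memOracle, h, block, Matrix.of_apply, kronecker_relabel_conj, if_pos ⟨trivial, trivial⟩]
  rfl

lemma queryProj_eq_kronecker (x : Fin n) :
    queryProj k x = (Matrix.single x x (1 : ℂ) ⊗ₖ (1 : Op Bool)) ⊗ₖ (1 : Op (Fin k → Bool)) := by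
  rw [← Matrix.diagonal_single, ← Matrix.diagonal_one, ← Matrix.diagonal_one,
    Matrix.diagonal_kronecker_diagonal, Matrix.diagonal_kronecker_diagonal, queryProj]
  congr 1
  ext m
  simp [Pi.single_apply]

/-- Sufficient condition for a call, given by its matrix entries, to be recording. The workspace
is mapped according to `g`, and `good e` tells which new workspace states signal `e`, where
`e = true` stands for the occurrence of an error. -/
lemma isRecordingCall_of_apply (N : NoiseKind) {p : ℝ} (hp : 0 < p) (hp1 : p ≤ 1)
    {call : (Fin n → Bool) → Op (Mem n k) → Op (Mem n k')}
    (good : Bool → (Fin k' → Bool) → Prop) [∀ e, DecidablePred (good e)]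
    (g : (Fin k' → Bool) → (Fin k → Bool)) (hg : ∀ e v, ∃! w, g w = v ∧ good e w)
    (h : ∀ f ρ a b, call f ρ a b =
      ((1 - p : ℝ) : ℂ) * (if good false a.2 ∧ good false b.2 then
        oracleChannel f (block ρ (g a.2) (g b.2)) a.1 b.1 else 0) +
      (p : ℂ) * (if good true a.2 ∧ good true b.2 then
        completeNoise N (oracleChannel f (block ρ (g a.2) (g b.2))) a.1 b.1 else 0)) :
    IsRecordingCall p call := by
  obtain ⟨K, _, c, r, hc, hr⟩ := exists_kraus_completeNoise N n
  have hsq {q : ℝ} (hq : 0 ≤ q) : ((Real.sqrt q : ℝ) : ℂ) * ((Real.sqrt q : ℝ) : ℂ) = q := by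
    rw [← Complex.ofReal_mul, Real.mul_self_sqrt hq]
  have hq : 0 ≤ 1 - p := sub_nonneg.2 hp1
  let J : Option K → Matrix (Mem n k') (Mem n k) ℂ
    | none => ((Real.sqrt (1 - p) : ℝ) : ℂ) • ((1 : Op (Query n)) ⊗ₖ relabel (good false) g)
    | some i => ((Real.sqrt p : ℝ) : ℂ) • (c i ⊗ₖ relabel (good true) g)
  have hnone : (J none)ᴴ * J none = ((1 - p : ℝ) : ℂ) • 1 := by
    simp only [J]
    rw [Matrix.conjTranspose_smul, Complex.star_def, Complex.conj_ofReal, Matrix.smul_mul,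
      Matrix.mul_smul, smul_smul, hsq hq, Matrix.conjTranspose_kronecker,
      ← Matrix.mul_kronecker_mul, relabel_isometry (hg false)]
    simp
  have hsome (i : K) : (J (some i))ᴴ * J (some i) = (p : ℂ) • (((c i)ᴴ * c i) ⊗ₖ 1) := by
    simp only [J]
    rw [Matrix.conjTranspose_smul, Complex.star_def, Complex.conj_ofReal, Matrix.smul_mul,
      Matrix.mul_smul, smul_smul, hsq hp.le, Matrix.conjTranspose_kronecker,
      ← Matrix.mul_kronecker_mul, relabel_isometry (hg true)]
  have hrec (x : Fin n) : ∑ i with r i = x, (J (some i))ᴴ * J (some i)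
      = (p : ℂ) • queryProj k x := by
    simp only [hsome]
    rw [← Finset.smul_sum, queryProj_eq_kronecker, ← hr x]
    congr 1
    ext a b
    simp [Matrix.sum_apply, Matrix.kroneckerMap_apply, Finset.sum_mul]
  have hall : ∑ i, (J i)ᴴ * J i = 1 := by
    rw [Fintype.sum_option, hnone, ← Finset.sum_fiberwise Finset.univ r]
    simp only [hrec]
    rw [← Finset.smul_sum, sum_queryProj, ← add_smul]
    simp
  refine ⟨Option K, inferInstance, J, Option.map r, fun f ρ => ?_, hall, fun x => ?_⟩
  · ext a b
    have e (q : ℝ) (hq : 0 ≤ q) (X : Matrix (Mem n k') (Mem n k) ℂ) (σ : Op (Mem n k)) :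
        (((Real.sqrt q : ℝ) : ℂ) • X) * σ * (((Real.sqrt q : ℝ) : ℂ) • X)ᴴ
          = (q : ℂ) • (X * σ * Xᴴ) := by
      rw [Matrix.conjTranspose_smul, Complex.star_def, Complex.conj_ofReal, Matrix.smul_mul,
        Matrix.mul_smul, Matrix.smul_mul, smul_smul, hsq hq]
    rw [Fintype.sum_option, h]
    simp only [J, e _ hq, e _ hp.le]
    rw [← Finset.smul_sum, Matrix.add_apply, Matrix.smul_apply, Matrix.smul_apply,
      Matrix.sum_apply]
    simp only [kronecker_relabel_conj, block_memOracle_conj, hc, smul_eq_mul]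
    congr 2
    · simp
    · split_ifs
      · rw [Matrix.sum_apply]
      · simp
  · rw [eq_sub_iff_add_eq, ← hall, ← Finset.sum_filter_add_sum_filter_not Finset.univ
      (fun i => Option.map r i ≠ some x) fun i => (J i)ᴴ * J i, ← hrec]
    congr 1
    simp [Finset.sum_filter, Fintype.sum_option]

lemma isRecordingCall_concealingCall (N : NoiseKind) {p : ℝ} (hp : 0 < p) (hp1 : p ≤ 1) :
    IsRecordingCall p fun (f : Fin n → Bool) (ρ : Op (Mem n k)) => concealingCall N p f ρ := by
  refine isRecordingCall_of_apply N hp hp1 (fun _ _ => True) id (fun _ v => ⟨v, by simp⟩) ?_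
  intro f ρ a b
  simp [concealingCall, noise]

lemma isRecordingCall_signalingCall (N : NoiseKind) {p : ℝ} (hp : 0 < p) (hp1 : p ≤ 1) :
    IsRecordingCall p fun (f : Fin n → Bool) (ρ : Op (Mem n k)) => signalingCall N p f ρ := by
  refine isRecordingCall_of_apply N hp hp1 (fun e w => w (Fin.last k) = e) Fin.init
    (fun e v => ⟨Fin.snoc v e, by simp, ?_⟩) ?_
  · rintro w ⟨rfl, rfl⟩
    exact (Fin.snoc_init_self w).symm
  · intro f ρ a b
    simp only [signalingCall, noiseFlag, Matrix.of_apply, Matrix.add_apply, Matrix.smul_apply,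
      Matrix.kroneckerMap_apply, Matrix.single_apply, smul_eq_mul, mul_ite, mul_one, mul_zero,
      eq_comm]

end Calls

/-! ### From algorithms to complexities -/

/-- A lower bound on the `τ` satisfying `P` bounds the least such `τ`, in the form of the
definitions of the two complexities. -/
lemma coe_le_iInf_of_forall {P : ℕ → Prop} {c : ℝ} (h : ∀ τ, P τ → c ≤ τ) :
    (c : EReal) ≤ (((⨅ (τ : ℕ) (_ : P τ), (τ : ℕ∞) : ℕ∞) : ℝ≥0∞) : EReal) := by
  generalize hC : (⨅ (τ : ℕ) (_ : P τ), (τ : ℕ∞)) = C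
  induction C using ENat.recTopCoe with
  | top => simp
  | coe m =>
    have hlt : (⨅ (τ : ℕ) (_ : P τ), (τ : ℕ∞)) < ((m + 1 : ℕ) : ℕ∞) := by
      rw [hC]; exact_mod_cast Nat.lt_succ_self m
    simp only [iInf_lt_iff, Nat.cast_lt] at hlt
    obtain ⟨τ, hτ, hm⟩ := hlt
    have h1 : c ≤ (m : ℝ) := (h τ hτ).trans (by exact_mod_cast Nat.lt_succ_iff.1 hm)
    have h2 : (((m : ℕ∞) : ℝ≥0∞) : EReal) = ((m : ℝ) : EReal) := by
      rw [ENat.toENNReal_coe]; rfl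
    rw [h2]
    exact_mod_cast h1

end

theorem theorem1 (N : NoiseKind) (n : ℕ) (p ε : ℝ) (hp : 0 < p) (hp1 : p ≤ 1) :
    ((((n : ℝ) * p * (1 - ε) / 49 - 1 : ℝ) : EReal) ≤
      ((concealingComplexity N n p ε : ℝ≥0∞) : EReal)) ∧
    ((((n : ℝ) * p * (1 - ε) / 49 - 1 : ℝ) : EReal) ≤
      ((signalingComplexity N n p ε : ℝ≥0∞) : EReal)) := by
  constructor
  · refine coe_le_iInf_of_forall ?_
    rintro τ ⟨l, A, hA⟩
    exact A.le_queries (call := fun _ f ρ => concealingCall N p f ρ) hp hp1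
      (fun _ => isRecordingCall_concealingCall N hp hp1) hA
  · refine coe_le_iInf_of_forall ?_
    rintro τ ⟨l, A, hA⟩
    exact A.le_queries (call := fun _ f ρ => signalingCall N p f ρ) hp hp1
      (fun _ => isRecordingCall_signalingCall N hp hp1) hA
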